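/- Call a set $E\subset\mathbb{R}^2$ a \emph{star-shaped Kakeya set} if it contains a line segment of length $1$ in every direction and if there is a point $O\in E$ such that for every $x\in E$ the line segment $Ox$ is contained in $E$. Every star-shaped Kakeya set $E\subset\mathbb{R}^2$, measurable or not, satisfies $$\mathcal{L}_2^*(E)\ \ge\ \frac{\pi}{98},$$ where $\mathcal{L}_2^*$ denotes the two-dimensional Lebesgue outer measure. -/

import Mathlib

open MeasureTheory

/-- A set `E` in the plane is star-shaped if it has a point `O` such that for every `x` in `E` the
line segment from `O` to `x` lies in `E`. -/
def IsStarShaped (E : Set (EuclideanSpace ℝ (Fin 2))) : Prop :=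
  ∃ O ∈ E, StarConvex ℝ O E

/-- A set `E` in the plane is a star-shaped Kakeya set if it is star-shaped and contains a (closed)
line segment of length one in every direction. No measurability or boundedness is required. -/
structure IsStarShapedKakeya (E : Set (EuclideanSpace ℝ (Fin 2))) : Prop where
  starShaped : IsStarShaped E
  exists_needle : ∀ v : EuclideanSpace ℝ (Fin 2), ‖v‖ = 1 → ∃ x, segment ℝ x (x + v) ⊆ E

/-! Outer measure allows `E` to be replaced by an open `U ⊇ E`. Of each needle, keep a piece of
length at least 1/4 whose coordinate along the needle, measured from the foot of the perpendicular
from `O`, is at least 1/4. By star-shapedness `E` contains the triangle over it with apex `O`; if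
its height `h` vanishes, a small shift inside `U` makes it nondegenerate
(`exists_needleTriangle_subset`). The triangle has area at least |h|/8, while it and the needle's
own direction lie in an angular interval of length at most 4|h|. These intervals cover `AddCircle
π`, and disjoint intervals give disjoint triangles (`disjoint_needleTriangle`). A Vitali selection
with enlargement 49/16 yields π ≤ (49/16) · 4 · 8 · area = 98 · area
(`pi_div_le_volume_of_needleTriangles`). -/

/-- The open triangle with vertices `(0, 0)`, `(1, 0)` and `(0, 1)`. -/
def openStdTriangle : Set (Fin 2 → ℝ) := {z | 0 < z 0 ∧ 0 < z 1 ∧ z 0 + z 1 < 1}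

lemma isOpen_openStdTriangle : IsOpen openStdTriangle := by
  refine (isOpen_lt continuous_const (continuous_apply 0)).inter
    ((isOpen_lt continuous_const (continuous_apply 1)).inter
      (isOpen_lt ((continuous_apply 0).add (continuous_apply 1)) continuous_const))

lemma volume_openStdTriangle : volume openStdTriangle = ENNReal.ofReal (1 / 2) := by
  have h : openStdTriangle = MeasurableEquiv.finTwoArrow (α := ℝ) ⁻¹'
      regionBetween (fun _ : ℝ => (0 : ℝ)) (fun x => 1 - x) (Set.Ioo 0 1) := by
    ext z
    simp only [openStdTriangle, regionBetween, Set.mem_ofPred_eq, Set.mem_preimage, Set.mem_Ioo,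
      MeasurableEquiv.finTwoArrow_apply]
    constructor
    · rintro ⟨h0, h1, h2⟩
      exact ⟨⟨h0, by linarith⟩, h1, by linarith⟩
    · rintro ⟨⟨h0, -⟩, h1, h2⟩
      exact ⟨h0, h1, by linarith⟩
  have hc : Continuous fun x : ℝ => 1 - x := by fun_prop
  rw [h, (volume_preserving_finTwoArrow ℝ).measure_preimage_equiv, Measure.volume_eq_prod,
    volume_regionBetween_eq_integral (by simp) ?_ measurableSet_Ioo]
  · congr 1
    rw [← integral_Ioc_eq_integral_Ioo, ← intervalIntegral.integral_of_le zero_le_one]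
    simp only [Pi.sub_apply, sub_zero]
    rw [intervalIntegral.integral_sub (by simp) (by simp)]
    norm_num
  · intro x hx
    linarith [hx.2]
  · exact (hc.integrableOn_Icc (a := 0) (b := 1)).mono_set Set.Ioo_subset_Icc_self

/-- The matrix whose columns are the points at positions `t₀` and `t₁` on the directed line of
angle `θ` lying at signed distance `h` from the origin. -/
noncomputable def needleMatrix (θ t₀ t₁ h : ℝ) : Matrix (Fin 2) (Fin 2) ℝ :=
  !![t₀ * Real.cos θ - h * Real.sin θ, t₁ * Real.cos θ - h * Real.sin θ;
    t₀ * Real.sin θ + h * Real.cos θ, t₁ * Real.sin θ + h * Real.cos θ]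

lemma det_needleMatrix (θ t₀ t₁ h : ℝ) : (needleMatrix θ t₀ t₁ h).det = h * (t₀ - t₁) := by
  rw [needleMatrix, Matrix.det_fin_two_of]
  linear_combination h * (t₀ - t₁) * Real.sin_sq_add_cos_sq θ

lemma needleMatrix_mulVec (θ t₀ t₁ h : ℝ) (z : Fin 2 → ℝ) :
    (needleMatrix θ t₀ t₁ h).mulVec z =
      ![(z 0 * t₀ + z 1 * t₁) * Real.cos θ - (z 0 + z 1) * h * Real.sin θ,
        (z 0 * t₀ + z 1 * t₁) * Real.sin θ + (z 0 + z 1) * h * Real.cos θ] := by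
  ext i
  fin_cases i <;> simp [needleMatrix, Matrix.mulVec, dotProduct, Fin.sum_univ_two] <;> ring

/-- The open triangle spanned by the origin and the columns of `needleMatrix`. -/
noncomputable def needleTriangle (θ t₀ t₁ h : ℝ) : Set (Fin 2 → ℝ) :=
  Matrix.toLin' (needleMatrix θ t₀ t₁ h) '' openStdTriangle

lemma volume_needleTriangle (θ t₀ t₁ h : ℝ) :
    volume (needleTriangle θ t₀ t₁ h) = ENNReal.ofReal (|h * (t₀ - t₁)| / 2) := by
  rw [needleTriangle, Measure.addHaar_image_linearMap, LinearMap.det_toLin', det_needleMatrix,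
    volume_openStdTriangle, ← ENNReal.ofReal_mul (abs_nonneg _), mul_one_div]

lemma measurableSet_needleTriangle {θ t₀ t₁ h : ℝ} (hh : h ≠ 0) (ht : t₀ < t₁) :
    MeasurableSet (needleTriangle θ t₀ t₁ h) := by
  have hd : LinearMap.det (Matrix.toLin' (needleMatrix θ t₀ t₁ h)) ≠ 0 := by
    rw [LinearMap.det_toLin', det_needleMatrix]
    exact mul_ne_zero hh (by linarith)
  let g := (LinearMap.equivOfDetNeZero _ hd).toContinuousLinearEquiv
  exact (g.toHomeomorph.isOpenMap _ isOpen_openStdTriangle).measurableSet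

/-- The ray through the point meets the needle line at position `1 / k ≥ t₀`, so its angle from `θ`
is `arctan (k * h)`, between 0 and `arctan (h / t₀)`. The interval is taken down to 0, not just to
`arctan (h / t₁)`, so that it contains the direction `θ` itself. -/
lemma exists_polar_of_mem_needleTriangle {θ t₀ t₁ h : ℝ} (h₀ : 0 < t₀) (ht : t₀ < t₁)
    {w : Fin 2 → ℝ} (hw : w ∈ needleTriangle θ t₀ t₁ h) :
    ∃ ρ φ : ℝ, 0 < ρ ∧ |φ - Real.arctan (h / t₀) / 2| ≤ |Real.arctan (h / t₀)| / 2 ∧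
      w = ![ρ * Real.cos (θ + φ), ρ * Real.sin (θ + φ)] := by
  obtain ⟨z, ⟨hz0, hz1, -⟩, rfl⟩ := hw
  set X := z 0 * t₀ + z 1 * t₁ with hX
  set k := (z 0 + z 1) / X with hk
  have hXpos : 0 < X := by have := h₀.trans ht; positivity
  have hkpos : 0 < k := by positivity
  have hkle : k * t₀ ≤ 1 := by
    rw [hk, div_mul_eq_mul_div, div_le_one hXpos]
    nlinarith
  set φ := Real.arctan (k * h) with hφ
  have hc : 0 < Real.cos φ := Real.cos_arctan_pos _
  have hs : Real.sin φ = k * h * Real.cos φ := by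
    rw [← Real.tan_arctan (k * h), Real.tan_mul_cos hc.ne']
  have hkX : k * X = z 0 + z 1 := div_mul_cancel₀ _ hXpos.ne'
  refine ⟨X / Real.cos φ, φ, by positivity, ?_, ?_⟩
  · have hdiv : k * h = (k * t₀) * (h / t₀) := by field_simp
    have hkt : 0 < k * t₀ := by positivity
    rcases le_total 0 h with hh | hh
    · have hq : 0 ≤ h / t₀ := by positivity
      have h1 : 0 ≤ φ := Real.arctan_nonneg.2 (by positivity)
      have h2 : φ ≤ Real.arctan (h / t₀) := Real.arctan_le_arctan_iff.2 (by rw [hdiv]; nlinarith)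
      rw [abs_of_nonneg (h1.trans h2), abs_le]
      constructor <;> linarith
    · have hq : h / t₀ ≤ 0 := div_nonpos_of_nonpos_of_nonneg hh h₀.le
      have h1 : φ ≤ 0 := Real.arctan_le_zero.2 (by nlinarith)
      have h2 : Real.arctan (h / t₀) ≤ φ := Real.arctan_le_arctan_iff.2 (by rw [hdiv]; nlinarith)
      rw [abs_of_nonpos (h2.trans h1), abs_le]
      constructor <;> linarith
  · rw [Matrix.toLin'_apply, needleMatrix_mulVec, Real.cos_add, Real.sin_add, hs, ← hX, ← hkX]
    ext i
    fin_cases i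
    · simp only [Fin.zero_eta, Matrix.cons_val_zero]
      field_simp
    · simp only [Fin.mk_one, Matrix.cons_val_one, Matrix.cons_val_zero]
      field_simp

lemma angle_coe_eq_of_polar_eq {ρ₁ ρ₂ x y : ℝ} (h₁ : 0 < ρ₁) (h₂ : 0 < ρ₂)
    (hc : ρ₁ * Real.cos x = ρ₂ * Real.cos y) (hs : ρ₁ * Real.sin x = ρ₂ * Real.sin y) :
    (x : AddCircle Real.pi) = y := by
  have hsin : Real.sin (x - y) = 0 := by
    have : ρ₁ * ρ₂ * Real.sin (x - y) = 0 := by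
      rw [Real.sin_sub]
      linear_combination ρ₂ * Real.cos y * hs - ρ₂ * Real.sin y * hc
    simpa [h₁.ne', h₂.ne'] using this
  obtain ⟨n, hn⟩ := Real.sin_eq_zero_iff.1 hsin
  rw [← sub_eq_zero, ← AddCircle.coe_sub, AddCircle.coe_eq_zero_iff]
  exact ⟨n, by simpa using hn⟩

/-- The directions seen from the origin in `needleTriangle θ t₀ t₁ h` form the closed ball in
`AddCircle π` with this centre and with radius `needleRadius t₀ h`. -/
noncomputable def needleCenter (θ t₀ h : ℝ) : AddCircle Real.pi :=
  ((θ + Real.arctan (h / t₀) / 2 : ℝ) : AddCircle Real.pi)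

/-- The radius of the ball of directions seen in a needle triangle. -/
noncomputable def needleRadius (t₀ h : ℝ) : ℝ := |Real.arctan (h / t₀)| / 2

lemma coe_mem_needleBall {θ t₀ h φ : ℝ}
    (hφ : |φ - Real.arctan (h / t₀) / 2| ≤ |Real.arctan (h / t₀)| / 2) :
    ((θ + φ : ℝ) : AddCircle Real.pi) ∈
      Metric.closedBall (needleCenter θ t₀ h) (needleRadius t₀ h) := by
  rw [Metric.mem_closedBall, dist_eq_norm, needleCenter, ← AddCircle.coe_sub]
  refine QuotientAddGroup.norm_mk_le_norm.trans ?_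
  rwa [add_sub_add_left_eq_sub]

lemma coe_mem_needleBall_self (θ t₀ h : ℝ) :
    (θ : AddCircle Real.pi) ∈ Metric.closedBall (needleCenter θ t₀ h) (needleRadius t₀ h) := by
  have := coe_mem_needleBall (θ := θ) (t₀ := t₀) (h := h) (φ := 0)
    (by rw [zero_sub, abs_neg, abs_div, abs_two])
  rwa [add_zero] at this

lemma needleRadius_pos {t₀ h : ℝ} (h₀ : 0 < t₀) (hh : h ≠ 0) : 0 < needleRadius t₀ h := by
  have : Real.arctan (h / t₀) ≠ 0 := by
    rw [Ne, Real.arctan_eq_zero_iff]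
    exact div_ne_zero hh h₀.ne'
  exact half_pos (abs_pos.2 this)

lemma abs_arctan_le_abs (x : ℝ) : |Real.arctan x| ≤ |x| := by
  have key : ∀ y : ℝ, 0 ≤ y → Real.arctan y ≤ y := fun y hy => by
    have := Real.le_tan (Real.arctan_nonneg.2 hy) (Real.arctan_lt_pi_div_two y)
    rwa [Real.tan_arctan] at this
  rcases le_total 0 x with hx | hx
  · rw [abs_of_nonneg (Real.arctan_nonneg.2 hx), abs_of_nonneg hx]
    exact key x hx
  · rw [abs_of_nonpos (Real.arctan_le_zero.2 hx), abs_of_nonpos hx, ← Real.arctan_neg]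
    exact key _ (neg_nonneg.2 hx)

lemma disjoint_needleTriangle {θ t₀ t₁ h θ' t₀' t₁' h' : ℝ} (h₀ : 0 < t₀) (ht : t₀ < t₁)
    (h₀' : 0 < t₀') (ht' : t₀' < t₁')
    (hd : Disjoint (Metric.closedBall (needleCenter θ t₀ h) (needleRadius t₀ h))
      (Metric.closedBall (needleCenter θ' t₀' h') (needleRadius t₀' h'))) :
    Disjoint (needleTriangle θ t₀ t₁ h) (needleTriangle θ' t₀' t₁' h') := by
  rw [Set.disjoint_left]
  intro w hw hw'
  obtain ⟨ρ, φ, hρ, hφ, rfl⟩ := exists_polar_of_mem_needleTriangle h₀ ht hw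
  obtain ⟨ρ', φ', hρ', hφ', heq⟩ := exists_polar_of_mem_needleTriangle h₀' ht' hw'
  have hx := congrFun heq 0
  have hy := congrFun heq 1
  simp only [Matrix.cons_val_zero, Matrix.cons_val_one] at hx hy
  have := angle_coe_eq_of_polar_eq hρ hρ' hx hy
  exact Set.disjoint_left.1 hd (coe_mem_needleBall hφ) (this ▸ coe_mem_needleBall hφ')

/-! ### Vitali covering of the circle of directions -/

/-- A set that contains, for each direction modulo `π`, a nondegenerate needle triangle at position
at least `1 / 4` and of length at least `1 / 4` has area at least `π / 98`. -/
theorem pi_div_le_volume_of_needleTriangles (V : Set (Fin 2 → ℝ))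
    (H : ∀ c : AddCircle Real.pi, ∃ θ t₀ t₁ h : ℝ, (θ : AddCircle Real.pi) = c ∧ 1 / 4 ≤ t₀ ∧
      t₀ + 1 / 4 ≤ t₁ ∧ h ≠ 0 ∧ needleTriangle θ t₀ t₁ h ⊆ V) :
    ENNReal.ofReal (Real.pi / 98) ≤ volume V := by
  have : Fact (0 < Real.pi) := ⟨Real.pi_pos⟩
  choose θ t₀ t₁ h hθ ht₀ ht₁ hh hV using H
  have h0 c : 0 < t₀ c := by linarith [ht₀ c]
  have h1 c : t₀ c < t₁ c := by linarith [ht₁ c]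
  let x c := needleCenter (θ c) (t₀ c) (h c)
  let r c := needleRadius (t₀ c) (h c)
  have hr c : 0 < r c := needleRadius_pos (h0 c) (hh c)
  have hrle c : r c ≤ Real.pi / 4 := by
    have := abs_lt.2 ⟨Real.neg_pi_div_two_lt_arctan (h c / t₀ c),
      Real.arctan_lt_pi_div_two (h c / t₀ c)⟩
    simp only [r, needleRadius]
    linarith
  -- Any factor above 3 is admissible; a factor τ gives the constant 32τ, and 49/16 makes it 98.
  obtain ⟨u, -, hdisj, hcov⟩ := Vitali.exists_disjoint_subfamily_covering_enlargement_closedBall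
    Set.univ x r (Real.pi / 4) (fun c _ => hrle c) (49 / 16) (by norm_num)
  have hu : u.Countable := hdisj.countable_of_nonempty_interior fun c _ =>
    ⟨x c, Metric.ball_subset_interior_closedBall (Metric.mem_ball_self (hr c))⟩
  have harea c : volume (Metric.closedBall (x c) (49 / 16 * r c)) ≤
      98 * volume (needleTriangle (θ c) (t₀ c) (t₁ c) (h c)) := by
    rw [AddCircle.volume_closedBall, volume_needleTriangle,
      show (98 : ENNReal) = ENNReal.ofReal 98 by norm_num, ← ENNReal.ofReal_mul (by norm_num)]
    refine ENNReal.ofReal_le_ofReal ((min_le_right _ _).trans ?_)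
    have ha : |Real.arctan (h c / t₀ c)| ≤ 4 * |h c| := by
      refine (abs_arctan_le_abs _).trans ?_
      rw [abs_div, abs_of_pos (h0 c), div_le_iff₀ (h0 c)]
      nlinarith [abs_nonneg (h c), ht₀ c]
    have hb : |h c| * (1 / 4) ≤ |h c * (t₀ c - t₁ c)| := by
      rw [abs_mul, abs_sub_comm, abs_of_pos (sub_pos.2 (h1 c))]
      exact mul_le_mul_of_nonneg_left (by linarith [ht₁ c]) (abs_nonneg _)
    simp only [r, needleRadius]
    linarith
  have hpi : ENNReal.ofReal Real.pi ≤ 98 * volume V :=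
    calc ENNReal.ofReal Real.pi
        = volume (Set.univ : Set (AddCircle Real.pi)) := (AddCircle.measure_univ Real.pi).symm
      _ ≤ volume (⋃ c ∈ u, Metric.closedBall (x c) (49 / 16 * r c)) := by
          -- Each direction `c` lies in its own ball, hence in the enlargement of a selected one.
          refine measure_mono fun c _ => ?_
          obtain ⟨b, hb, hsub⟩ := hcov c (Set.mem_univ c)
          refine Set.mem_biUnion hb (hsub ?_)
          have := coe_mem_needleBall_self (θ c) (t₀ c) (h c)
          rwa [hθ c] at this
      _ ≤ ∑' c : u, volume (Metric.closedBall (x c) (49 / 16 * r c)) := measure_biUnion_le _ hu _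
      _ ≤ ∑' c : u, 98 * volume (needleTriangle (θ c) (t₀ c) (t₁ c) (h c)) :=
          ENNReal.tsum_le_tsum fun c => harea c
      _ = 98 * volume (⋃ c ∈ u, needleTriangle (θ c) (t₀ c) (t₁ c) (h c)) := by
          rw [ENNReal.tsum_mul_left, measure_biUnion hu]
          · exact fun a ha b hb hab => disjoint_needleTriangle (h0 a) (h1 a) (h0 b) (h1 b)
              (hdisj ha hb hab)
          · exact fun c _ => measurableSet_needleTriangle (hh c) (h1 c)
      _ ≤ 98 * volume V := by
          gcongr
          exact Set.iUnion₂_subset fun c _ => hV c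
  rw [ENNReal.ofReal_div_of_pos (by norm_num)]
  refine ENNReal.div_le_of_le_mul' ?_
  simpa using hpi

/-! ### Far triangles from needles -/

/-- In a neighbourhood of a star-shaped set with a needle in every direction one finds, for each
direction modulo `π`, a nondegenerate needle triangle far from the centre. -/
lemma exists_needleTriangle_subset {E U : Set (EuclideanSpace ℝ (Fin 2))}
    {O : EuclideanSpace ℝ (Fin 2)} (hO : StarConvex ℝ O E)
    (hE : ∀ v : EuclideanSpace ℝ (Fin 2), ‖v‖ = 1 → ∃ x, segment ℝ x (x + v) ⊆ E)
    (hU : IsOpen U) (hEU : E ⊆ U) (c : AddCircle Real.pi) :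
    ∃ θ t₀ t₁ h : ℝ, (θ : AddCircle Real.pi) = c ∧ 1 / 4 ≤ t₀ ∧ t₀ + 1 / 4 ≤ t₁ ∧ h ≠ 0 ∧
      needleTriangle θ t₀ t₁ h ⊆ {w | O + WithLp.toLp 2 w ∈ U} := by
  -- a point of the plane in coordinates along and across the direction `θ`
  let P (θ t b : ℝ) : EuclideanSpace ℝ (Fin 2) :=
    O + !₂[t * Real.cos θ - b * Real.sin θ, t * Real.sin θ + b * Real.cos θ]
  have needle (θ : ℝ) : ∃ a b : ℝ, ∀ t ∈ Set.Icc a (a + 1), P θ t b ∈ E := by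
    obtain ⟨x, hx⟩ := hE !₂[Real.cos θ, Real.sin θ] (by
      simp [EuclideanSpace.norm_eq, Fin.sum_univ_two])
    refine ⟨(x 0 - O 0) * Real.cos θ + (x 1 - O 1) * Real.sin θ,
      (x 1 - O 1) * Real.cos θ - (x 0 - O 0) * Real.sin θ, fun t ht => hx ?_⟩
    rw [segment_eq_image']
    refine ⟨t - ((x 0 - O 0) * Real.cos θ + (x 1 - O 1) * Real.sin θ),
      ⟨by linarith [ht.1], by linarith [ht.2]⟩, ?_⟩
    ext i
    fin_cases i
    · simp [P]
      linear_combination (O 0 - x 0) * Real.sin_sq_add_cos_sq θ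
    · simp [P]
      linear_combination (O 1 - x 1) * Real.sin_sq_add_cos_sq θ
  have far : ∃ θ a b : ℝ, (θ : AddCircle Real.pi) = c ∧ -(1 / 2) ≤ a ∧
      ∀ t ∈ Set.Icc a (a + 1), P θ t b ∈ E := by
    obtain ⟨θ, rfl⟩ := QuotientAddGroup.mk_surjective c
    obtain ⟨a, b, hab⟩ := needle θ
    by_cases ha : -(1 / 2) ≤ a
    · exact ⟨θ, a, b, rfl, ha, hab⟩
    -- Reversing the line sends `[a, a + 1]` to `[-(a + 1), -a]`, with the same direction modulo π.
    -- Once `a ≥ -1/2`, the needle reaches 1/2, leaving length 1/4 beyond 1/4.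
    · refine ⟨θ + Real.pi, -(a + 1), -b, AddCircle.coe_add_period _ _, by linarith, fun t ht => ?_⟩
      have := hab (-t) ⟨by linarith [ht.2], by linarith [ht.1]⟩
      convert this using 1
      simp only [P, Real.cos_add_pi, Real.sin_add_pi]
      ring_nf
  obtain ⟨θ, a, b, hθ, ha, hab⟩ := far
  let F (b : ℝ) (z : Fin 2 → ℝ) : EuclideanSpace ℝ (Fin 2) :=
    O + WithLp.toLp 2 ((needleMatrix θ (max a (1 / 4)) (a + 1) b).mulVec z)
  have hF : Continuous fun p : ℝ × (Fin 2 → ℝ) => F p.1 p.2 := by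
    simp only [F, needleMatrix_mulVec]
    fun_prop
  let K : Set (Fin 2 → ℝ) := Set.Icc 0 1 ∩ {z | z 0 + z 1 ≤ 1}
  have hK : IsCompact K := isCompact_Icc.inter_right
    (isClosed_le (by fun_prop) continuous_const)
  have hFE : ∀ z ∈ K, F b z ∈ E := by
    rintro z ⟨⟨hz0, hz1⟩, hz⟩
    have z0 : 0 ≤ z 0 := hz0 0
    have z1 : 0 ≤ z 1 := hz0 1
    have hz : z 0 + z 1 ≤ 1 := hz
    have hm : a ≤ max a (1 / 4) := le_max_left _ _
    have hm' : max a (1 / 4) ≤ a + 1 := max_le (by linarith) (by linarith)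
    rcases (add_nonneg z0 z1).eq_or_lt with hs | hs
    · have e0 : z 0 = 0 := by linarith
      have e1 : z 1 = 0 := by linarith
      have hmem := hO (hab a ⟨le_rfl, by linarith⟩) zero_le_one le_rfl (add_zero 1)
      convert hmem using 1
      simp only [F, needleMatrix_mulVec, e0, e1]
      ext i
      fin_cases i <;> simp
    · set t := (z 0 * max a (1 / 4) + z 1 * (a + 1)) / (z 0 + z 1) with ht
      have htmul : z 0 * max a (1 / 4) + z 1 * (a + 1) = (z 0 + z 1) * t := by
        rw [ht]; field_simp
      have hmem := hO (hab t ⟨by rw [ht, le_div_iff₀ hs]; nlinarith,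
        by rw [ht, div_le_iff₀ hs]; nlinarith⟩) (sub_nonneg.2 hz) hs.le (sub_add_cancel 1 _)
      convert hmem using 1
      simp only [F, P, needleMatrix_mulVec, htmul]
      ext i
      fin_cases i <;> simp <;> ring
  -- Compactness of the closed triangle lets one neighbourhood of `b` serve all `z`; it contains
  -- some `h ≠ 0` even when the needle line passes through `O`.
  have hev : ∀ᶠ h in nhds b, ∀ z ∈ K, F h z ∈ U :=
    hK.eventually_forall_of_forall_eventually fun z hz =>
      hF.continuousAt.eventually (hU.mem_nhds (hEU (hFE z hz)))
  obtain ⟨h, hh, hne⟩ : ∃ h, (∀ z ∈ K, F h z ∈ U) ∧ h ≠ 0 := by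
    obtain ⟨h, hne, hh⟩ := (dense_compl_singleton (0 : ℝ)).inter_nhds_nonempty hev
    exact ⟨h, hh, hne⟩
  refine ⟨θ, max a (1 / 4), a + 1, h, hθ, le_max_right _ _, ?_, hne, ?_⟩
  · rcases max_cases a (1 / 4) with ⟨e, -⟩ | ⟨e, -⟩ <;> rw [e] <;> linarith
  · rintro _ ⟨z, ⟨z0, z1, hz⟩, rfl⟩
    refine hh z ⟨⟨fun i => ?_, fun i => ?_⟩, hz.le⟩
    · fin_cases i
      exacts [z0.le, z1.le]
    · fin_cases i
      · simp only [Fin.zero_eta, Pi.one_apply]; linarith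
      · simp only [Fin.mk_one, Pi.one_apply]; linarith

/-- `volume E` is the Lebesgue outer measure of `E`: on a set that need not be measurable, a measure
takes the value of its outer measure. -/
theorem theorem1 (E : Set (EuclideanSpace ℝ (Fin 2))) (hE : IsStarShapedKakeya E) :
    ENNReal.ofReal (Real.pi / 98) ≤ volume E := by
  obtain ⟨O, -, hO⟩ := hE.starShaped
  rw [E.measure_eq_iInf_isOpen volume]
  refine le_iInf₂ fun U hEU => le_iInf fun hU => ?_
  have hvol : volume {w : Fin 2 → ℝ | O + WithLp.toLp 2 w ∈ U} = volume U :=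
    ((measurePreserving_add_left volume O).comp
      (PiLp.volume_preserving_toLp (Fin 2))).measure_preimage hU.measurableSet.nullMeasurableSet
  rw [← hvol]
  exact pi_div_le_volume_of_needleTriangles _
    (exists_needleTriangle_subset hO hE.exists_needle hU hEU)
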